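/- Let $k\ge 1$ and $n\ge m\ge 0$, $\ell\ge 0$ be integers. A linear $k$-chord diagram of length $kn$ is a partition of the linearly ordered vertices $1,\dots,kn$ into $n$ blocks of size $k$, called $k$-chords. A $k$-chord is \emph{short} if its vertices are adjacent (form an interval of consecutive vertices). Two distinct $k$-chords $A,B$ \emph{cross} if there are vertices $a<b<a'<b'$ with $a,a'$ in one of them and $b,b'$ in the other; $A$ \emph{contains} $B$ if every vertex of $B$ lies strictly between two vertices of $A$. A $k$-chord of a diagram is a \emph{non-crossing chord} if it is not crossed by any other $k$-chord of the diagram and contains only non-crossing chords (recursively). Let $d_{n,\ell,m}$ be the number of linear $k$-chord diagrams of length $kn$ with exactly $\ell$ short chords and exactly $m$ non-crossing chords, let $d_{n,0}$ be the number of linear $k$-chord diagrams of length $kn$ without short chords, let $T_{m,\ell}$ be the number of linear $k$-chord diagrams of length $km$ in which no two $k$-chords cross and which have exactly $\ell$ short chords, and let $T(x,y)=\sum_{m,\ell\ge 0}T_{m,\ell}\,x^m y^\ell$ as a formal power series. Then $$d_{n,\ell,m}=\left([x^m y^\ell]\,T(x,y)^{kn-km+1}\right)d_{n-m,0}.$$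 -/

import Mathlib

namespace KChord

section Chords

variable {V : Type*} [LinearOrder V]

/-- `D` is a `k`-chord diagram on the linearly arranged vertex set `V`: a set of `k`-chords
(sets of `k` vertices) such that each vertex participates in exactly one of them. -/
def IsDiagram (k : ℕ) (D : Finset (Finset V)) : Prop :=
  (∀ A ∈ D, A.card = k) ∧ ∀ v : V, ∃! A, A ∈ D ∧ v ∈ A

/-- A short chord is formed on a set of adjacent vertices: no vertex is skipped between two of
its vertices. -/
def IsShort (A : Finset V) : Prop := (A : Set V).OrdConnected

/-- Vertices of `A` and `B` alternate as `A, B, A, B` from left to right. -/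
def Alternate (A B : Finset V) : Prop :=
  ∃ a ∈ A, ∃ b ∈ B, ∃ a' ∈ A, ∃ b' ∈ B, a < b ∧ b < a' ∧ a' < b'

/-- Two (distinct) chords cross each other. -/
def Crosses (A B : Finset V) : Prop := Alternate A B ∨ Alternate B A

/-- The chord `A` contains the chord `B`: every vertex of `B` lies strictly between two vertices
of `A`. -/
def Contains (A B : Finset V) : Prop := ∀ b ∈ B, ∃ a ∈ A, ∃ a' ∈ A, a < b ∧ b < a'

/-- A non-crossing chord of `D` is a chord of `D` that is not crossed by any other chord of `D`
and only contains other non-crossing chords (containment of nonempty chords is a strict order, so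
this recursion is well founded). -/
inductive IsNonCrossingChord (D : Finset (Finset V)) : Finset V → Prop
  | intro (A : Finset V) (mem : A ∈ D)
      (not_crossed : ∀ B ∈ D, B ≠ A → ¬ Crosses A B)
      (contained : ∀ B ∈ D, Contains A B → IsNonCrossingChord D B) : IsNonCrossingChord D A

/-- No two chords of `D` cross each other. -/
def IsNonCrossingDiagram (D : Finset (Finset V)) : Prop :=
  ∀ A ∈ D, ∀ B ∈ D, B ≠ A → ¬ Crosses A B

/-- The number of short chords of `D`. -/
noncomputable def numShort (D : Finset (Finset V)) : ℕ := {A | A ∈ D ∧ IsShort A}.ncard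

/-- The number of non-crossing chords of `D`. -/
noncomputable def numNonCrossing (D : Finset (Finset V)) : ℕ :=
  {A | IsNonCrossingChord D A}.ncard

end Chords

/-- The number of linear `k`-chord diagrams of length `k * n` with exactly `l` short chords. -/
noncomputable def dShort (k n l : ℕ) : ℕ :=
  {D : Finset (Finset (Fin (k * n))) | IsDiagram k D ∧ numShort D = l}.ncard

/-- The number of linear `k`-chord diagrams of length `k * n` with exactly `l` short chords and
exactly `m` non-crossing chords. -/
noncomputable def d (k n l m : ℕ) : ℕ :=
  {D : Finset (Finset (Fin (k * n))) |
    IsDiagram k D ∧ numShort D = l ∧ numNonCrossing D = m}.ncard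

/-- The number of non-crossing linear `k`-chord diagrams of length `k * m` with exactly `l` short
chords. -/
noncomputable def numNC (k m l : ℕ) : ℕ :=
  {D : Finset (Finset (Fin (k * m))) |
    IsDiagram k D ∧ IsNonCrossingDiagram D ∧ numShort D = l}.ncard

/-- The generating function `T(x, y) = ∑ T_{m,l} x^m y^l` of the non-crossing diagrams, a formal
power series in the variables `x` (index `0`) and `y` (index `1`). -/
noncomputable def T (k : ℕ) : MvPowerSeries (Fin 2) ℕ := fun e => numNC k (e 0) (e 1)

end KChord

/-!
Let `N` be the set of non-crossing chords of a diagram `D` and `R` the set of the others. A vertex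
between two vertices of a non-crossing chord `A` belongs to `A` or to a chord contained in `A`, so
it is covered by `N`: the system `N` is "hull-closed". An innermost non-crossing chord is short, and
conversely a chord that becomes short after deletion of the vertices of `N` is non-crossing in `D`
(`isNonCrossingChord_of_between`). Hence `R` has no short chord relative to its own vertices, and
`D ↦ (N, R)` is a bijection onto the pairs consisting of a hull-closed non-crossing system `N` and a
diagram `R` on the vertices left free by `N` without relatively short chords; the short chords of
`D` are those of `N`. The number of choices for `R` depends only on the number of free vertices,
which gives `ncard_diagrams_eq`.

It remains to count the hull-closed non-crossing systems. No chord of such a system spans a free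
vertex, so `e` free vertices cut it into `e + 1` non-crossing diagrams on intervals. Splitting at
the first free vertex (`ncard_closedSystems_succ`) matches the coefficient formula for `T * T ^ e`,
and induction on `e` yields `ncard_closedSystems`.

Chords live in an arbitrary linear order; order embeddings (`relabel`) move them between `Fin L`,
the free vertices of a system, and intervals of `ℕ`.
-/

namespace KChord

/-! ### Systems of disjoint chords -/

section Systems

variable {V W : Type*}

/-- A set of pairwise disjoint `k`-chords, which need not cover all vertices. -/
structure IsSystem (k : ℕ) (D : Finset (Finset V)) : Prop where
  card_eq : ∀ A ∈ D, A.card = k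
  eq_of_mem : ∀ A ∈ D, ∀ B ∈ D, ∀ v, v ∈ A → v ∈ B → A = B

theorem IsSystem.mono {k : ℕ} {D E : Finset (Finset V)} (hD : IsSystem k D) (h : E ⊆ D) :
    IsSystem k E :=
  ⟨fun A hA => hD.card_eq A (h hA), fun A hA B hB => hD.eq_of_mem A (h hA) B (h hB)⟩

theorem IsSystem.nonempty {k : ℕ} {D : Finset (Finset V)} (hD : IsSystem k D) (hk : 1 ≤ k)
    {A : Finset V} (hA : A ∈ D) : A.Nonempty := by
  rw [← Finset.card_pos, hD.card_eq A hA]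
  exact hk

variable [LinearOrder V] [LinearOrder W]

/-- The vertices covered by a set of chords. -/
def vertices (D : Finset (Finset V)) : Finset V := D.biUnion id

/-- No vertex covered by `D` is skipped between two vertices of `A`: `A` is short once the vertices
not covered by `D` are deleted. -/
def IsRelShort (D : Finset (Finset V)) (A : Finset V) : Prop :=
  ∀ a ∈ A, ∀ a' ∈ A, ∀ v ∈ vertices D, a < v → v < a' → v ∈ A

/-- No chord of `D` spans a vertex that is not covered by `D`. -/
def HullClosed (D : Finset (Finset V)) : Prop :=
  ∀ A ∈ D, ∀ a ∈ A, ∀ a' ∈ A, ∀ v, a < v → v < a' → v ∈ vertices D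

theorem mem_vertices {D : Finset (Finset V)} {v : V} : v ∈ vertices D ↔ ∃ A ∈ D, v ∈ A := by
  simp [vertices]

theorem vertices_union (D E : Finset (Finset V)) :
    vertices (D ∪ E) = vertices D ∪ vertices E := by
  ext v
  simp only [mem_vertices, Finset.mem_union, or_and_right, exists_or]

theorem IsSystem.card_vertices {k : ℕ} {D : Finset (Finset V)} (hD : IsSystem k D) :
    (vertices D).card = k * D.card := by
  unfold vertices
  rw [Finset.card_biUnion, Finset.sum_congr rfl (g := fun _ => k), Finset.sum_const, smul_eq_mul,
    mul_comm]
  · exact fun A hA => hD.card_eq A hA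
  · intro A hA B hB hne
    exact Finset.disjoint_left.2 fun v hvA hvB => hne (hD.eq_of_mem A hA B hB v hvA hvB)

theorem IsSystem.union {k : ℕ} {D E : Finset (Finset V)} (hD : IsSystem k D)
    (hE : IsSystem k E) (h : Disjoint (vertices D) (vertices E)) : IsSystem k (D ∪ E) := by
  have key : ∀ A ∈ D, ∀ B ∈ E, ∀ v, v ∈ A → v ∈ B → False := fun A hA B hB v hvA hvB =>
    Finset.disjoint_left.1 h (mem_vertices.2 ⟨A, hA, hvA⟩) (mem_vertices.2 ⟨B, hB, hvB⟩)
  refine ⟨fun A hA => ?_, fun A hA B hB v hvA hvB => ?_⟩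
  · rcases Finset.mem_union.1 hA with hA | hA
    exacts [hD.card_eq A hA, hE.card_eq A hA]
  · rcases Finset.mem_union.1 hA with hA | hA <;> rcases Finset.mem_union.1 hB with hB | hB
    · exact hD.eq_of_mem A hA B hB v hvA hvB
    · exact (key A hA B hB v hvA hvB).elim
    · exact (key B hB A hA v hvB hvA).elim
    · exact hE.eq_of_mem A hA B hB v hvA hvB

theorem IsSystem.disjoint_of_disjoint_vertices {k : ℕ} {D E : Finset (Finset V)}
    (hD : IsSystem k D) (hk : 1 ≤ k) (h : Disjoint (vertices D) (vertices E)) : Disjoint D E := by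
  refine Finset.disjoint_left.2 fun A hA hA' => ?_
  obtain ⟨v, hv⟩ := hD.nonempty hk hA
  exact Finset.disjoint_left.1 h (mem_vertices.2 ⟨A, hA, hv⟩) (mem_vertices.2 ⟨A, hA', hv⟩)

theorem IsSystem.disjoint_vertices {k : ℕ} {D E F : Finset (Finset V)} (hF : IsSystem k F)
    (hD : D ⊆ F) (hE : E ⊆ F) (h : Disjoint D E) : Disjoint (vertices D) (vertices E) := by
  refine Finset.disjoint_left.2 fun v hv hv' => ?_
  obtain ⟨A, hA, hvA⟩ := mem_vertices.1 hv
  obtain ⟨B, hB, hvB⟩ := mem_vertices.1 hv'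
  have := hF.eq_of_mem A (hD hA) B (hE hB) v hvA hvB
  exact Finset.disjoint_left.1 h hA (this ▸ hB)

theorem isDiagram_iff [Fintype V] {k : ℕ} {D : Finset (Finset V)} :
    IsDiagram k D ↔ IsSystem k D ∧ vertices D = Finset.univ := by
  constructor
  · rintro ⟨h1, h2⟩
    refine ⟨⟨h1, fun A hA B hB v hvA hvB => (h2 v).unique ⟨hA, hvA⟩ ⟨hB, hvB⟩⟩, ?_⟩
    refine Finset.eq_univ_of_forall fun v => ?_
    obtain ⟨A, ⟨hA, hv⟩, -⟩ := h2 v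
    exact mem_vertices.2 ⟨A, hA, hv⟩
  · rintro ⟨h1, h2⟩
    refine ⟨h1.card_eq, fun v => ?_⟩
    obtain ⟨A, hA, hv⟩ := mem_vertices.1 (h2 ▸ Finset.mem_univ v : v ∈ vertices D)
    exact ⟨A, ⟨hA, hv⟩, fun B hB => h1.eq_of_mem B hB.1 A hA v hB.2 hv⟩

theorem Crosses.symm {A B : Finset V} (h : Crosses A B) : Crosses B A := Or.symm h

theorem HullClosed.isShort_iff {D : Finset (Finset V)} (hD : HullClosed D) {A : Finset V}
    (hA : A ∈ D) : IsShort A ↔ IsRelShort D A := by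
  constructor
  · intro h a ha a' ha' v _ h1 h2
    exact h.out ha ha' ⟨h1.le, h2.le⟩
  · intro h
    refine ⟨fun a ha a' ha' v hv => ?_⟩
    rcases hv.1.eq_or_lt with rfl | h1
    · exact ha
    rcases hv.2.eq_or_lt with rfl | h2
    · exact ha'
    exact h a ha a' ha' v (hD A hA a ha a' ha' v h1 h2) h1 h2

theorem hullClosed_of_vertices_eq_univ [Fintype V] {D : Finset (Finset V)}
    (h : vertices D = Finset.univ) : HullClosed D := by
  intro A _ a _ a' _ v _ _
  simp [h]

theorem numShort_eq_card (D : Finset (Finset V)) [DecidablePred (IsShort (V := V))] :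
    numShort D = (D.filter IsShort).card := by
  rw [numShort, ← Set.ncard_coe_finset]
  congr 1
  ext A
  simp

theorem numShort_union {D E : Finset (Finset V)} (h : Disjoint D E) :
    numShort (D ∪ E) = numShort D + numShort E := by
  classical
  rw [numShort_eq_card, numShort_eq_card, numShort_eq_card, Finset.filter_union,
    Finset.card_union_of_disjoint (Finset.disjoint_filter_filter h)]

theorem numShort_eq_zero_iff {D : Finset (Finset V)} :
    numShort D = 0 ↔ ∀ A ∈ D, ¬ IsShort A := by
  classical
  rw [numShort_eq_card, Finset.card_eq_zero, Finset.filter_eq_empty_iff]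

/-! ### Relabelling the vertices -/

/-- The chords of `D` with their vertices relabelled by `f`. -/
def relabel (f : V ↪o W) (D : Finset (Finset V)) : Finset (Finset W) :=
  D.map ⟨Finset.map f.toEmbedding, Finset.map_injective _⟩

theorem relabel_injective (f : V ↪o W) : Function.Injective (relabel f) :=
  Finset.map_injective _

theorem forall_mem_relabel {f : V ↪o W} {D : Finset (Finset V)} {p : Finset W → Prop} :
    (∀ A ∈ relabel f D, p A) ↔ ∀ A ∈ D, p (A.map f.toEmbedding) := by
  simp [relabel]

theorem vertices_relabel (f : V ↪o W) (D : Finset (Finset V)) :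
    vertices (relabel f D) = (vertices D).map f.toEmbedding := by
  ext w
  simp only [mem_vertices, relabel, Finset.mem_map, Function.Embedding.coeFn_mk]
  constructor
  · rintro ⟨_, ⟨A, hA, rfl⟩, hw⟩
    obtain ⟨v, hv, rfl⟩ := Finset.mem_map.1 hw
    exact ⟨v, ⟨A, hA, hv⟩, rfl⟩
  · rintro ⟨v, ⟨A, hA, hv⟩, rfl⟩
    exact ⟨_, ⟨A, hA, rfl⟩, Finset.mem_map_of_mem _ hv⟩

theorem isSystem_relabel {k : ℕ} {f : V ↪o W} {D : Finset (Finset V)} :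
    IsSystem k (relabel f D) ↔ IsSystem k D := by
  constructor
  · rintro ⟨h1, h2⟩
    rw [forall_mem_relabel] at h1 h2
    refine ⟨fun A hA => by simpa using h1 A hA, fun A hA B hB v hvA hvB => ?_⟩
    have := forall_mem_relabel.1 (h2 A hA) B hB (f v) (Finset.mem_map_of_mem _ hvA)
      (Finset.mem_map_of_mem _ hvB)
    exact Finset.map_injective _ this
  · rintro ⟨h1, h2⟩
    refine ⟨forall_mem_relabel.2 fun A hA => by simpa using h1 A hA,
      forall_mem_relabel.2 fun A hA => forall_mem_relabel.2 fun B hB w hw hw' => ?_⟩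
    obtain ⟨v, hv, rfl⟩ := Finset.mem_map.1 hw
    rw [h2 A hA B hB v hv (by simpa using hw')]

theorem alternate_map {f : V ↪o W} {A B : Finset V} :
    Alternate (A.map f.toEmbedding) (B.map f.toEmbedding) ↔ Alternate A B := by
  simp [Alternate]

theorem isNonCrossingDiagram_relabel {f : V ↪o W} {D : Finset (Finset V)} :
    IsNonCrossingDiagram (relabel f D) ↔ IsNonCrossingDiagram D := by
  simp only [IsNonCrossingDiagram, forall_mem_relabel, Crosses, alternate_map, ne_eq,
    (Finset.map_injective f.toEmbedding).eq_iff]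

theorem isRelShort_relabel {f : V ↪o W} {D : Finset (Finset V)} {A : Finset V} :
    IsRelShort (relabel f D) (A.map f.toEmbedding) ↔ IsRelShort D A := by
  simp [IsRelShort, vertices_relabel]

theorem isShort_map {f : V ↪o W} (hf : (Set.range f).OrdConnected) {A : Finset V} :
    IsShort (A.map f.toEmbedding) ↔ IsShort A := by
  constructor
  · intro h
    refine ⟨fun a ha a' ha' v hv => ?_⟩
    have : f v ∈ (A.map f.toEmbedding : Set W) :=
      h.out (Finset.mem_coe.2 (Finset.mem_map_of_mem _ ha))
        (Finset.mem_coe.2 (Finset.mem_map_of_mem _ ha'))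
        ⟨f.le_iff_le.2 hv.1, f.le_iff_le.2 hv.2⟩
    simpa using this
  · intro h
    refine ⟨fun b hb b' hb' w hw => ?_⟩
    obtain ⟨a, ha, rfl⟩ := Finset.mem_map.1 (Finset.mem_coe.1 hb)
    obtain ⟨a', ha', rfl⟩ := Finset.mem_map.1 (Finset.mem_coe.1 hb')
    obtain ⟨v, rfl⟩ := hf.out ⟨a, rfl⟩ ⟨a', rfl⟩ hw
    exact Finset.mem_coe.2 (Finset.mem_map_of_mem _
      (h.out ha ha' ⟨f.le_iff_le.1 hw.1, f.le_iff_le.1 hw.2⟩))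

theorem numShort_relabel {f : V ↪o W} (hf : (Set.range f).OrdConnected)
    (D : Finset (Finset V)) : numShort (relabel f D) = numShort D := by
  classical
  rw [numShort_eq_card, numShort_eq_card, relabel, Finset.filter_map, Finset.card_map]
  congr 1
  exact Finset.filter_congr fun A _ => isShort_map hf

theorem hullClosed_relabel {f : V ↪o W} (hf : (Set.range f).OrdConnected)
    {D : Finset (Finset V)} : HullClosed (relabel f D) ↔ HullClosed D := by
  rw [HullClosed, forall_mem_relabel, HullClosed, vertices_relabel]
  refine forall₂_congr fun A hA => ⟨fun h a ha a' ha' v h1 h2 => ?_, ?_⟩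
  · simpa using h (f a) (Finset.mem_map_of_mem _ ha) (f a') (Finset.mem_map_of_mem _ ha') (f v)
      (f.lt_iff_lt.2 h1) (f.lt_iff_lt.2 h2)
  · intro h b hb b' hb' w h1 h2
    obtain ⟨a, ha, rfl⟩ := Finset.mem_map.1 hb
    obtain ⟨a', ha', rfl⟩ := Finset.mem_map.1 hb'
    obtain ⟨v, rfl⟩ := hf.out ⟨a, rfl⟩ ⟨a', rfl⟩ ⟨h1.le, h2.le⟩
    exact Finset.mem_map_of_mem _ (h a ha a' ha' v (f.lt_iff_lt.1 h1) (f.lt_iff_lt.1 h2))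

theorem exists_relabel_eq [Fintype V] {f : V ↪o W} {E : Finset (Finset W)}
    (h : vertices E ⊆ Finset.univ.map f.toEmbedding) : ∃ D, relabel f D = E := by
  have : E ⊆ (Finset.univ : Finset (Finset V)).map
      ⟨Finset.map f.toEmbedding, Finset.map_injective _⟩ := by
    intro B hB
    have hB' : B ⊆ Finset.univ.map f.toEmbedding := fun w hw => h (mem_vertices.2 ⟨B, hB, hw⟩)
    obtain ⟨A, -, rfl⟩ := Finset.subset_map_iff.1 hB'
    exact Finset.mem_map.2 ⟨A, Finset.mem_univ _, rfl⟩
  obtain ⟨D, -, rfl⟩ := Finset.subset_map_iff.1 this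
  exact ⟨D, rfl⟩

/-- The diagrams without short chords that live on a prescribed vertex set `S` are counted by
`dShort`, shortness being understood relative to `S`. -/
theorem ncard_systems_on_eq_dShort {k n : ℕ} {S : Finset V} (hS : S.card = k * n) :
    {R : Finset (Finset V) | IsSystem k R ∧ vertices R = S ∧ ∀ A ∈ R, ¬ IsRelShort R A}.ncard =
      dShort k n 0 := by
  rw [dShort, ← Set.ncard_image_of_injective _ (relabel_injective (S.orderEmbOfFin hS))]
  congr 1
  ext R
  simp only [Set.mem_ofPred_eq, Set.mem_image]
  have hmap : Finset.univ.map (S.orderEmbOfFin hS).toEmbedding = S :=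
    Finset.map_orderEmbOfFin_univ S hS
  constructor
  · rintro ⟨h1, h2, h3⟩
    obtain ⟨D, rfl⟩ := exists_relabel_eq (f := S.orderEmbOfFin hS) (E := R) (by rw [hmap, h2])
    have hD : vertices D = Finset.univ := by
      rw [vertices_relabel] at h2
      exact Finset.map_injective _ (h2.trans hmap.symm)
    refine ⟨D, ⟨isDiagram_iff.2 ⟨isSystem_relabel.1 h1, hD⟩, numShort_eq_zero_iff.2 ?_⟩, rfl⟩
    intro A hA
    rw [(hullClosed_of_vertices_eq_univ hD).isShort_iff hA]
    exact fun h => forall_mem_relabel.1 h3 A hA (isRelShort_relabel.2 h)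
  · rintro ⟨D, ⟨h1, h2⟩, rfl⟩
    obtain ⟨h1, hD⟩ := isDiagram_iff.1 h1
    refine ⟨isSystem_relabel.2 h1, by rw [vertices_relabel, hD, hmap],
      forall_mem_relabel.2 fun A hA => ?_⟩
    rw [isRelShort_relabel, ← (hullClosed_of_vertices_eq_univ hD).isShort_iff hA]
    exact numShort_eq_zero_iff.1 h2 A hA

/-! ### Non-crossing chords -/

/-- A chord that does not cross `A` but has a vertex between two vertices of `A` is contained
in `A`. -/
theorem contains_of_not_crosses {k : ℕ} {D : Finset (Finset V)} (hD : IsSystem k D)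
    {A B : Finset V} (hA : A ∈ D) (hB : B ∈ D) (hne : B ≠ A) (hAB : ¬ Crosses A B)
    {a a' v : V} (ha : a ∈ A) (ha' : a' ∈ A) (hv : v ∈ B) (h1 : a < v) (h2 : v < a') :
    Contains A B := by
  intro b hb
  have hbA : ∀ x ∈ A, x ≠ b := fun x hx hxb =>
    hne (hD.eq_of_mem B hB A hA b hb (hxb ▸ hx))
  by_cases hl : b < a
  · exact (hAB (Or.inr ⟨b, hb, a, ha, v, hv, a', ha', hl, h1, h2⟩)).elim
  by_cases hr : a' < b
  · exact (hAB (Or.inl ⟨a, ha, v, hv, a', ha', b, hb, h1, h2, hr⟩)).elim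
  exact ⟨a, ha, a', ha', lt_of_le_of_ne (not_lt.1 hl) (hbA a ha),
    lt_of_le_of_ne (not_lt.1 hr) (hbA a' ha').symm⟩

theorem IsNonCrossingChord.mem {D : Finset (Finset V)} {A : Finset V}
    (h : IsNonCrossingChord D A) : A ∈ D := by
  cases h; assumption

theorem IsNonCrossingChord.not_crosses {D : Finset (Finset V)} {A : Finset V}
    (h : IsNonCrossingChord D A) {B : Finset V} (hB : B ∈ D) (hne : B ≠ A) : ¬ Crosses A B := by
  cases h with
  | intro _ _ h2 _ => exact h2 B hB hne

theorem IsNonCrossingChord.of_contains {D : Finset (Finset V)} {A : Finset V}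
    (h : IsNonCrossingChord D A) {B : Finset V} (hB : B ∈ D) (hAB : Contains A B) :
    IsNonCrossingChord D B := by
  cases h with
  | intro _ _ _ h3 => exact h3 B hB hAB

/-- Every chord with a vertex between two vertices of a non-crossing chord is itself
non-crossing. -/
theorem IsNonCrossingChord.of_between {k : ℕ} {D : Finset (Finset V)} (hD : IsSystem k D)
    {A B : Finset V} (h : IsNonCrossingChord D A) (hB : B ∈ D) {a a' v : V} (ha : a ∈ A)
    (ha' : a' ∈ A) (hv : v ∈ B) (h1 : a < v) (h2 : v < a') : IsNonCrossingChord D B := by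
  by_cases hne : B = A
  · rwa [hne]
  · exact h.of_contains hB
      (contains_of_not_crosses hD h.mem hB hne (h.not_crosses hB hne) ha ha' hv h1 h2)

/-- An innermost non-crossing chord is short. -/
theorem IsNonCrossingChord.exists_isRelShort {k : ℕ} {D : Finset (Finset V)}
    (hD : IsSystem k D) {A : Finset V} (h : IsNonCrossingChord D A) :
    ∃ B ∈ D, IsRelShort D B := by
  induction h with
  | intro A hA h2 _ ih =>
    by_cases hs : IsRelShort D A
    · exact ⟨A, hA, hs⟩
    · unfold IsRelShort at hs
      push Not at hs
      obtain ⟨a, ha, a', ha', v, hv, hav, hva', hvA⟩ := hs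
      obtain ⟨B, hB, hvB⟩ := mem_vertices.1 hv
      have hne : B ≠ A := fun h => hvA (h ▸ hvB)
      exact ih B hB (contains_of_not_crosses hD hA hB hne (h2 B hB hne) ha ha' hvB hav hva')

theorem IsNonCrossingChord.mono {D E : Finset (Finset V)} (hED : E ⊆ D) {A : Finset V}
    (h : IsNonCrossingChord D A) (hA : A ∈ E) : IsNonCrossingChord E A := by
  induction h with
  | intro A _ h2 _ ih =>
    exact .intro A hA (fun B hB => h2 B (hED hB)) fun B hB hAB => ih B (hED hB) hAB hB

theorem not_contains_self {A : Finset V} (hA : A.Nonempty) : ¬ Contains A A := by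
  intro h
  obtain ⟨-, -, a', ha', -, hlt⟩ := h _ (A.max'_mem hA)
  exact (A.le_max' a' ha').not_gt hlt

/-- A chord all of whose spanned vertices lie on itself or on non-crossing chords is
non-crossing. -/
theorem isNonCrossingChord_of_between {k : ℕ} (hk : 1 ≤ k) {D : Finset (Finset V)}
    (hD : IsSystem k D) {A : Finset V} (hA : A ∈ D)
    (h : ∀ a ∈ A, ∀ a' ∈ A, ∀ B ∈ D, ∀ v ∈ B, a < v → v < a' → B = A ∨ IsNonCrossingChord D B) :
    IsNonCrossingChord D A := by
  refine .intro A hA (fun B hB hne hc => ?_) fun B hB hAB => ?_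
  · have hBN : IsNonCrossingChord D B := by
      rcases hc with ⟨a, ha, b, hb, a', ha', b', hb', h1, h2, h3⟩ |
        ⟨b, hb, a, ha, b', hb', a', ha', h1, h2, h3⟩
      · exact (h a ha a' ha' B hB b hb h1 h2).resolve_left hne
      · exact (h a ha a' ha' B hB b' hb' h2 h3).resolve_left hne
    exact hBN.not_crosses hA hne.symm hc.symm
  · obtain ⟨b, hb⟩ := hD.nonempty hk hB
    obtain ⟨a, ha, a', ha', h1, h2⟩ := hAB b hb
    refine (h a ha a' ha' B hB b hb h1 h2).resolve_left ?_
    rintro rfl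
    exact not_contains_self ⟨b, hb⟩ hAB

/-- Chords of a hull-closed non-crossing system stay non-crossing chords when further chords are
put on the uncovered vertices. -/
theorem isNonCrossingChord_union [WellFoundedLT V] {k : ℕ} (hk : 1 ≤ k)
    {N R : Finset (Finset V)} (hN : IsSystem k N) (hR : IsSystem k R) (hcl : HullClosed N)
    (hnc : IsNonCrossingDiagram N) (hdisj : Disjoint (vertices N) (vertices R)) {A : Finset V}
    (hA : A ∈ N) : IsNonCrossingChord (N ∪ R) A := by
  -- A chord contained in `A` has a smaller greatest vertex, which makes the induction work.
  have key : ∀ x : V, ∀ A ∈ N, IsGreatest (A : Set V) x → IsNonCrossingChord (N ∪ R) A := by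
    intro x
    induction x using WellFoundedLT.induction with
    | ind x ih =>
      intro A hA hx
      have between : ∀ B ∈ N ∪ R, ∀ a ∈ A, ∀ a' ∈ A, ∀ b ∈ B, a < b → b < a' → B ∈ N := by
        intro B hB a ha a' ha' b hb h1 h2
        refine (Finset.mem_union.1 hB).resolve_right fun hBR => ?_
        exact Finset.disjoint_left.1 hdisj (hcl A hA a ha a' ha' b h1 h2)
          (mem_vertices.2 ⟨B, hBR, hb⟩)
      refine .intro A (Finset.mem_union_left _ hA) (fun B hB hne hc => ?_) fun B hB hAB => ?_
      · have hBN : B ∈ N := by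
          rcases hc with ⟨a, ha, b, hb, a', ha', b', hb', h1, h2, h3⟩ |
            ⟨b, hb, a, ha, b', hb', a', ha', h1, h2, h3⟩
          · exact between B hB a ha a' ha' b hb h1 h2
          · exact between B hB a ha a' ha' b' hb' h2 h3
        exact hnc A hA B hBN hne hc
      · have hBne : B.Nonempty := by
          rcases Finset.mem_union.1 hB with hB | hB
          exacts [hN.nonempty hk hB, hR.nonempty hk hB]
        obtain ⟨a, ha, a', ha', h1, h2⟩ := hAB _ (B.max'_mem hBne)
        exact ih _ (h2.trans_le (hx.2 ha')) B
          (between B hB a ha a' ha' _ (B.max'_mem hBne) h1 h2) (B.isGreatest_max' hBne)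
  exact key _ A hA (A.isGreatest_max' (hN.nonempty hk hA))

/-- If moreover the further chords have no short chord among them, they do not produce
non-crossing chords. -/
theorem isNonCrossingChord_union_iff [WellFoundedLT V] {k : ℕ} (hk : 1 ≤ k)
    {N R : Finset (Finset V)} (hN : IsSystem k N) (hR : IsSystem k R) (hcl : HullClosed N)
    (hnc : IsNonCrossingDiagram N) (hdisj : Disjoint (vertices N) (vertices R))
    (hshort : ∀ A ∈ R, ¬ IsRelShort R A) {A : Finset V} :
    IsNonCrossingChord (N ∪ R) A ↔ A ∈ N := by
  refine ⟨fun h => ?_, isNonCrossingChord_union hk hN hR hcl hnc hdisj⟩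
  refine (Finset.mem_union.1 h.mem).resolve_right fun hAR => ?_
  obtain ⟨B, hB, hBs⟩ := (h.mono Finset.subset_union_right hAR).exists_isRelShort hR
  exact hshort B hB hBs

theorem numNonCrossing_eq_card (D : Finset (Finset V))
    [DecidablePred (IsNonCrossingChord D)] :
    numNonCrossing D = (D.filter (IsNonCrossingChord D)).card := by
  rw [numNonCrossing, ← Set.ncard_coe_finset]
  congr 1
  ext A
  simpa using IsNonCrossingChord.mem

theorem IsSystem.isNonCrossingChord_of_isShort {k : ℕ} (hk : 1 ≤ k) {D : Finset (Finset V)}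
    (hD : IsSystem k D) {A : Finset V} (hA : A ∈ D) (hs : IsShort A) :
    IsNonCrossingChord D A :=
  isNonCrossingChord_of_between hk hD hA fun _ ha _ ha' B hB v hv h1 h2 =>
    Or.inl (hD.eq_of_mem B hB A hA v hv (hs.out ha ha' ⟨h1.le, h2.le⟩))

theorem numShort_filter_isNonCrossingChord {k : ℕ} (hk : 1 ≤ k) {D : Finset (Finset V)}
    (hD : IsSystem k D) [DecidablePred (IsNonCrossingChord D)] :
    numShort (D.filter (IsNonCrossingChord D)) = numShort D := by
  unfold numShort
  congr 1
  ext A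
  simp only [Set.mem_ofPred_eq, Finset.mem_filter]
  exact ⟨fun h => ⟨h.1.1, h.2⟩,
    fun h => ⟨⟨h.1, hD.isNonCrossingChord_of_isShort hk h.1 h.2⟩, h.2⟩⟩

/-! ### Splitting off the non-crossing chords -/

/-- `N` is a hull-closed non-crossing system of `u 0` chords, of which `u 1` are short. The counts are
packed into `u` to match the exponents of the power series `T k`. -/
structure IsClosedSystem (k : ℕ) (u : Fin 2 →₀ ℕ) (N : Finset (Finset V)) : Prop where
  isSystem : IsSystem k N
  nonCrossing : IsNonCrossingDiagram N
  hullClosed : HullClosed N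
  card_eq : N.card = u 0
  numShort_eq : numShort N = u 1

theorem isClosedSystem_filter [Fintype V] {k : ℕ} (hk : 1 ≤ k) {D : Finset (Finset V)}
    (hD : IsDiagram k D) [DecidablePred (IsNonCrossingChord D)] {u : Fin 2 →₀ ℕ}
    (h0 : numNonCrossing D = u 0) (h1 : numShort D = u 1) :
    IsClosedSystem k u (D.filter (IsNonCrossingChord D)) := by
  obtain ⟨hs, huniv⟩ := isDiagram_iff.1 hD
  refine ⟨hs.mono (Finset.filter_subset _ _), ?_, ?_, ?_, ?_⟩
  · intro A hA B hB hne
    exact (Finset.mem_filter.1 hA).2.not_crosses (Finset.mem_filter.1 hB).1 hne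
  · intro A hA a ha a' ha' v hav hva'
    obtain ⟨B, hB, hvB⟩ := mem_vertices.1 (huniv ▸ Finset.mem_univ v : v ∈ vertices D)
    exact mem_vertices.2 ⟨B, Finset.mem_filter.2 ⟨hB,
      (Finset.mem_filter.1 hA).2.of_between hs hB ha ha' hvB hav hva'⟩, hvB⟩
  · rw [← h0, numNonCrossing_eq_card]
  · rw [numShort_filter_isNonCrossingChord hk hs, h1]

/-- Let `R` consist of chords of `D`, among them all that are not non-crossing. A chord of `R` that
is not non-crossing in `D` is not short relative to `R`. -/
theorem not_isRelShort_of_not_isNonCrossingChord {k : ℕ} (hk : 1 ≤ k) {D : Finset (Finset V)}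
    (hD : IsSystem k D) {R : Finset (Finset V)} (hRD : R ⊆ D)
    (hR : ∀ A ∈ D, ¬ IsNonCrossingChord D A → A ∈ R) {A : Finset V} (hA : A ∈ R)
    (hnc : ¬ IsNonCrossingChord D A) : ¬ IsRelShort R A := by
  intro hs
  refine hnc (isNonCrossingChord_of_between hk hD (hRD hA) fun a ha a' ha' B hB v hv h1 h2 => ?_)
  by_cases hBn : IsNonCrossingChord D B
  · exact Or.inr hBn
  · exact Or.inl (hD.eq_of_mem B hB A (hRD hA) v hv
      (hs a ha a' ha' v (mem_vertices.2 ⟨B, hR B hB hBn, hv⟩) h1 h2))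

/-- Removing the non-crossing chords leaves an arbitrary diagram without short chords on the
remaining vertices. -/
theorem ncard_diagrams_eq [Fintype V] {k n m l : ℕ} (hk : 1 ≤ k) (hV : Fintype.card V = k * n)
    {u : Fin 2 →₀ ℕ} (hu0 : u 0 = m) (hu1 : u 1 = l) :
    {D : Finset (Finset V) | IsDiagram k D ∧ numShort D = l ∧ numNonCrossing D = m}.ncard =
      {N : Finset (Finset V) | IsClosedSystem k u N}.ncard * dShort k (n - m) 0 := by
  classical
  rw [Set.ncard_eq_toFinset_card', Set.ncard_eq_toFinset_card',
    Finset.card_eq_sum_card_fiberwise (f := fun D => D.filter (IsNonCrossingChord D))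
      (t := {N : Finset (Finset V) | IsClosedSystem k u N}.toFinset),
    Finset.sum_const_nat]
  · intro N hN
    rw [Set.mem_toFinset] at hN
    have hcard : (vertices N)ᶜ.card = k * (n - m) := by
      rw [Finset.card_compl, hN.isSystem.card_vertices, hV, hN.card_eq, hu0, Nat.mul_sub]
    rw [← ncard_systems_on_eq_dShort hcard, Set.ncard_eq_toFinset_card']
    symm
    have hdisj : ∀ R : Finset (Finset V), vertices R = (vertices N)ᶜ →
        Disjoint (vertices N) (vertices R) := fun R hR => by
      rw [hR]; exact disjoint_compl_right
    refine Finset.card_nbij (fun R => N ∪ R) ?_ ?_ ?_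
    · intro R hR
      simp only [Finset.mem_coe, Set.mem_toFinset, Set.mem_ofPred_eq] at hR
      obtain ⟨h1, h2, h3⟩ := hR
      have hiff := fun A => isNonCrossingChord_union_iff (A := A) hk hN.isSystem h1 hN.hullClosed
        hN.nonCrossing (hdisj R h2) h3
      have hfil : (N ∪ R).filter (IsNonCrossingChord (N ∪ R)) = N := by
        ext A
        rw [Finset.mem_filter, hiff A]
        exact ⟨fun h => h.2, fun h => ⟨Finset.mem_union_left _ h, h⟩⟩
      have hsys := hN.isSystem.union h1 (hdisj R h2)
      simp only [Finset.mem_coe, Finset.mem_filter, Set.mem_toFinset, Set.mem_ofPred_eq]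
      refine ⟨⟨isDiagram_iff.2 ⟨hsys, ?_⟩, ?_, ?_⟩, hfil⟩
      · rw [vertices_union, h2, Finset.union_compl]
      · rw [← numShort_filter_isNonCrossingChord hk hsys, hfil, hN.numShort_eq, hu1]
      · rw [numNonCrossing_eq_card, hfil, hN.card_eq, hu0]
    · intro R hR R' hR' heq
      simp only [Set.coe_toFinset, Set.mem_ofPred_eq] at hR hR'
      have hd := hN.isSystem.disjoint_of_disjoint_vertices hk (hdisj R hR.2.1)
      have hd' := hN.isSystem.disjoint_of_disjoint_vertices hk (hdisj R' hR'.2.1)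
      have heq' : N ∪ R = N ∪ R' := heq
      rw [← Finset.union_sdiff_cancel_left hd, heq', Finset.union_sdiff_cancel_left hd']
    · intro D hD
      simp only [Finset.coe_filter, Set.mem_toFinset, Set.mem_ofPred_eq] at hD
      obtain ⟨⟨h1, h2, h3⟩, rfl⟩ := hD
      obtain ⟨hs, huniv⟩ := isDiagram_iff.1 h1
      have hunion : D.filter (IsNonCrossingChord D) ∪ D.filter (fun A => ¬ IsNonCrossingChord D A)
          = D := Finset.filter_union_filter_not_eq _ _
      refine ⟨D.filter fun A => ¬ IsNonCrossingChord D A, ?_, hunion⟩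
      simp only [Set.coe_toFinset, Set.mem_ofPred_eq]
      refine ⟨hs.mono (Finset.filter_subset _ _), ?_, fun A hA => ?_⟩
      · have hd := hs.disjoint_vertices (Finset.filter_subset _ _) (Finset.filter_subset _ _)
          (Finset.disjoint_filter_filter_not D D (IsNonCrossingChord D))
        rw [eq_compl_iff_isCompl]
        refine ⟨hd.symm, codisjoint_iff.2 ?_⟩
        rw [sup_comm, Finset.sup_eq_union, ← vertices_union, hunion, huniv]
        rfl
      · exact not_isRelShort_of_not_isNonCrossingChord hk hs (Finset.filter_subset _ _)
          (fun B hB hBn => Finset.mem_filter.2 ⟨hB, hBn⟩) hA (Finset.mem_filter.1 hA).2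
  · intro D hD
    simp only [Set.coe_toFinset, Set.mem_ofPred_eq] at hD ⊢
    exact isClosedSystem_filter hk hD.1 (hD.2.2.trans hu0.symm) (hD.2.1.trans hu1.symm)

theorem isClosedSystem_relabel {k : ℕ} {u : Fin 2 →₀ ℕ} {f : V ↪o W}
    (hf : (Set.range f).OrdConnected) {N : Finset (Finset V)} :
    IsClosedSystem k u (relabel f N) ↔ IsClosedSystem k u N := by
  have hc : (relabel f N).card = N.card := Finset.card_map _
  constructor
  · rintro ⟨h1, h2, h3, h4, h5⟩
    exact ⟨isSystem_relabel.1 h1, isNonCrossingDiagram_relabel.1 h2, (hullClosed_relabel hf).1 h3,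
      hc ▸ h4, numShort_relabel hf N ▸ h5⟩
  · rintro ⟨h1, h2, h3, h4, h5⟩
    exact ⟨isSystem_relabel.2 h1, isNonCrossingDiagram_relabel.2 h2, (hullClosed_relabel hf).2 h3,
      hc.trans h4, (numShort_relabel hf N).trans h5⟩

end Systems

/-! ### Counting closed systems on an interval -/

/-- The closed systems of chords on the vertices `a, …, b - 1`. -/
def closedSystems (k a b : ℕ) (u : Fin 2 →₀ ℕ) : Set (Finset (Finset ℕ)) :=
  {N | IsClosedSystem k u N ∧ vertices N ⊆ Finset.Ico a b}

theorem finite_closedSystems (k a b : ℕ) (u : Fin 2 →₀ ℕ) : (closedSystems k a b u).Finite := by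
  refine (Finset.finite_toSet (Finset.Ico a b).powerset.powerset).subset fun N hN => ?_
  simp only [Finset.mem_coe, Finset.mem_powerset]
  exact fun A hA => Finset.mem_powerset.2 fun v hv => hN.2 (mem_vertices.2 ⟨A, hA, hv⟩)

theorem ncard_closedSystems_add (k a L : ℕ) (u : Fin 2 →₀ ℕ) :
    (closedSystems k a (a + L) u).ncard =
      {N : Finset (Finset (Fin L)) | IsClosedSystem k u N}.ncard := by
  let f : Fin L ↪o ℕ := OrderEmbedding.ofStrictMono (fun i : Fin L => a + i) fun i j h => by
    simpa using h
  have hmap : Finset.univ.map f.toEmbedding = Finset.Ico a (a + L) := by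
    ext x
    simp only [Finset.mem_map, Finset.mem_univ, true_and, Finset.mem_Ico]
    constructor
    · rintro ⟨i, rfl⟩
      have := i.2
      change a ≤ a + (i : ℕ) ∧ a + (i : ℕ) < a + L
      omega
    · intro h
      refine ⟨⟨x - a, by omega⟩, ?_⟩
      change a + (x - a) = x
      omega
  have hf : (Set.range f).OrdConnected := by
    have : Set.range f = Set.Ico a (a + L) := by
      rw [← Finset.coe_Ico, ← hmap]
      simp
    rw [this]
    exact Set.ordConnected_Ico
  rw [← Set.ncard_image_of_injective _ (relabel_injective f)]
  congr 1
  ext N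
  simp only [closedSystems, Set.mem_ofPred_eq, Set.mem_image]
  constructor
  · rintro ⟨h1, h2⟩
    obtain ⟨D, rfl⟩ := exists_relabel_eq (f := f) (hmap ▸ h2)
    exact ⟨D, (isClosedSystem_relabel hf).1 h1, rfl⟩
  · rintro ⟨D, hD, rfl⟩
    refine ⟨(isClosedSystem_relabel hf).2 hD, ?_⟩
    rw [vertices_relabel, ← hmap]
    exact Finset.map_subset_map.2 (Finset.subset_univ _)

/-- A closed system that leaves no vertex free is a non-crossing diagram. -/
theorem ncard_closedSystems_full {k : ℕ} (hk : 1 ≤ k) (a : ℕ) (u : Fin 2 →₀ ℕ) :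
    (closedSystems k a (a + k * u 0) u).ncard = MvPowerSeries.coeff u (T k) := by
  rw [ncard_closedSystems_add]
  change _ = numNC k (u 0) (u 1)
  rw [numNC]
  congr 1
  ext N
  simp only [Set.mem_ofPred_eq, isDiagram_iff]
  constructor
  · rintro ⟨h1, h2, -, h4, h5⟩
    refine ⟨⟨h1, Finset.eq_univ_of_card _ ?_⟩, h2, h5⟩
    rw [h1.card_vertices, h4, Fintype.card_fin]
  · rintro ⟨⟨h1, h2⟩, h3, h4⟩
    refine ⟨h1, h3, hullClosed_of_vertices_eq_univ h2, ?_, h4⟩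
    have hc := h1.card_vertices
    rw [h2, Finset.card_univ, Fintype.card_fin] at hc
    exact (Nat.eq_of_mul_eq_mul_left hk hc).symm

theorem union_mem_closedSystems {k a p b : ℕ} (hk : 1 ≤ k) (hap : a ≤ p) (hpb : p < b)
    {u₁ u₂ : Fin 2 →₀ ℕ} {N₁ N₂ : Finset (Finset ℕ)} (h₁ : N₁ ∈ closedSystems k a p u₁)
    (h₂ : N₂ ∈ closedSystems k (p + 1) b u₂) : N₁ ∪ N₂ ∈ closedSystems k a b (u₁ + u₂) := by
  obtain ⟨h₁, hv₁⟩ := h₁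
  obtain ⟨h₂, hv₂⟩ := h₂
  have hdisj : Disjoint (vertices N₁) (vertices N₂) := by
    refine Finset.disjoint_left.2 fun v hv hv' => ?_
    have := Finset.mem_Ico.1 (hv₁ hv)
    have := Finset.mem_Ico.1 (hv₂ hv')
    omega
  have hd := h₁.isSystem.disjoint_of_disjoint_vertices hk hdisj
  have hlt : ∀ A ∈ N₁, ∀ x ∈ A, ∀ B ∈ N₂, ∀ y ∈ B, x < y := by
    intro A hA x hx B hB y hy
    have := Finset.mem_Ico.1 (hv₁ (mem_vertices.2 ⟨A, hA, hx⟩))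
    have := Finset.mem_Ico.1 (hv₂ (mem_vertices.2 ⟨B, hB, hy⟩))
    omega
  have hcross : ∀ A ∈ N₁, ∀ B ∈ N₂, ¬ Crosses A B := by
    rintro A hA B hB (⟨x, hx, y, hy, x', hx', y', hy', h1, h2, h3⟩ |
      ⟨y, hy, x, hx, y', hy', x', hx', h1, h2, h3⟩)
    · exact lt_asymm h2 (hlt A hA x' hx' B hB y hy)
    · exact lt_asymm h1 (hlt A hA x hx B hB y hy)
  refine ⟨⟨h₁.isSystem.union h₂.isSystem hdisj, ?_, ?_, ?_, ?_⟩, ?_⟩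
  · intro A hA B hB hne
    rcases Finset.mem_union.1 hA with hA | hA <;> rcases Finset.mem_union.1 hB with hB | hB
    · exact h₁.nonCrossing A hA B hB hne
    · exact hcross A hA B hB
    · exact fun h => hcross B hB A hA h.symm
    · exact h₂.nonCrossing A hA B hB hne
  · intro A hA x hx y hy v h1 h2
    rw [vertices_union]
    rcases Finset.mem_union.1 hA with hA | hA
    · exact Finset.mem_union_left _ (h₁.hullClosed A hA x hx y hy v h1 h2)
    · exact Finset.mem_union_right _ (h₂.hullClosed A hA x hx y hy v h1 h2)
  · rw [Finset.card_union_of_disjoint hd, h₁.card_eq, h₂.card_eq, Finsupp.add_apply]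
  · rw [numShort_union hd, h₁.numShort_eq, h₂.numShort_eq, Finsupp.add_apply]
  · rw [vertices_union]
    exact Finset.union_subset (hv₁.trans (Finset.Ico_subset_Ico le_rfl hpb.le))
      (hv₂.trans (Finset.Ico_subset_Ico (by omega) le_rfl))

/-- A closed system splits at each uncovered vertex. -/
theorem exists_union_eq_of_notMem_vertices {k a p b : ℕ} (hk : 1 ≤ k) {u : Fin 2 →₀ ℕ}
    {N : Finset (Finset ℕ)} (hN : N ∈ closedSystems k a b u) (hp : p ∉ vertices N) :
    ∃ u₁ u₂ : Fin 2 →₀ ℕ, u₁ + u₂ = u ∧ ∃ N₁ ∈ closedSystems k a p u₁,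
      ∃ N₂ ∈ closedSystems k (p + 1) b u₂, N₁ ∪ N₂ = N := by
  classical
  obtain ⟨hN, hv⟩ := hN
  let N₁ := N.filter fun A => ∀ v ∈ A, v < p
  let N₂ := N.filter fun A => ∀ v ∈ A, p < v
  have hs₁ : N₁ ⊆ N := Finset.filter_subset _ _
  have hs₂ : N₂ ⊆ N := Finset.filter_subset _ _
  have hlt₁ : ∀ A ∈ N₁, ∀ v ∈ A, v < p := fun A hA => (Finset.mem_filter.1 hA).2
  have hlt₂ : ∀ A ∈ N₂, ∀ v ∈ A, p < v := fun A hA => (Finset.mem_filter.1 hA).2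
  have hpA : ∀ A ∈ N, ∀ v ∈ A, v ≠ p := fun A hA v hvA h =>
    hp (mem_vertices.2 ⟨A, hA, h ▸ hvA⟩)
  have hunion : N₁ ∪ N₂ = N := by
    refine subset_antisymm (Finset.union_subset hs₁ hs₂) fun A hA => ?_
    by_cases h : ∀ v ∈ A, v < p
    · exact Finset.mem_union_left _ (Finset.mem_filter.2 ⟨hA, h⟩)
    · push Not at h
      obtain ⟨w, hw, hpw⟩ := h
      refine Finset.mem_union_right _ (Finset.mem_filter.2 ⟨hA, fun v hvA => ?_⟩)
      -- otherwise `A` has vertices on both sides of `p`, which would then be covered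
      by_contra hvp
      exact hp (hN.hullClosed A hA v hvA w hw p (lt_of_le_of_ne (not_lt.1 hvp) (hpA A hA v hvA))
        (lt_of_le_of_ne hpw (hpA A hA w hw).symm))
  have hd : Disjoint N₁ N₂ := by
    refine Finset.disjoint_left.2 fun A hA hA' => ?_
    obtain ⟨v, hvA⟩ := hN.isSystem.nonempty hk (hs₁ hA)
    exact lt_asymm (hlt₁ A hA v hvA) (hlt₂ A hA' v hvA)
  have hcov : ∀ v ∈ vertices N, (v < p → v ∈ vertices N₁) ∧ (p < v → v ∈ vertices N₂) := by
    intro v hvN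
    rw [← hunion, vertices_union, Finset.mem_union, mem_vertices, mem_vertices] at hvN
    rcases hvN with ⟨A, hA, hvA⟩ | ⟨A, hA, hvA⟩
    · exact ⟨fun _ => mem_vertices.2 ⟨A, hA, hvA⟩, fun h => (lt_asymm h (hlt₁ A hA v hvA)).elim⟩
    · exact ⟨fun h => (lt_asymm h (hlt₂ A hA v hvA)).elim, fun _ => mem_vertices.2 ⟨A, hA, hvA⟩⟩
  refine ⟨Finsupp.single 0 N₁.card + Finsupp.single 1 (numShort N₁),
    Finsupp.single 0 N₂.card + Finsupp.single 1 (numShort N₂), ?_, N₁, ⟨⟨?_, ?_, ?_, ?_, ?_⟩, ?_⟩,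
    N₂, ⟨⟨?_, ?_, ?_, ?_, ?_⟩, ?_⟩, hunion⟩
  · have hc := hN.card_eq
    have hsh := hN.numShort_eq
    rw [← hunion, Finset.card_union_of_disjoint hd] at hc
    rw [← hunion, numShort_union hd] at hsh
    ext i
    fin_cases i
    · simpa using hc
    · simpa using hsh
  · exact hN.isSystem.mono hs₁
  · exact fun A hA B hB => hN.nonCrossing A (hs₁ hA) B (hs₁ hB)
  · intro A hA x hx y hy v h1 h2
    exact (hcov v (hN.hullClosed A (hs₁ hA) x hx y hy v h1 h2)).1 (h2.trans (hlt₁ A hA y hy))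
  · simp
  · simp
  · intro v hv₁
    obtain ⟨A, hA, hvA⟩ := mem_vertices.1 hv₁
    have := Finset.mem_Ico.1 (hv (mem_vertices.2 ⟨A, hs₁ hA, hvA⟩))
    exact Finset.mem_Ico.2 ⟨this.1, hlt₁ A hA v hvA⟩
  · exact hN.isSystem.mono hs₂
  · exact fun A hA B hB => hN.nonCrossing A (hs₂ hA) B (hs₂ hB)
  · intro A hA x hx y hy v h1 h2
    exact (hcov v (hN.hullClosed A (hs₂ hA) x hx y hy v h1 h2)).2 ((hlt₂ A hA x hx).trans h1)
  · simp
  · simp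
  · intro v hv₂
    obtain ⟨A, hA, hvA⟩ := mem_vertices.1 hv₂
    have := Finset.mem_Ico.1 (hv (mem_vertices.2 ⟨A, hs₂ hA, hvA⟩))
    exact Finset.mem_Ico.2 ⟨hlt₂ A hA v hvA, this.2⟩

/-- A closed system on an interval of the exact size covers the interval. -/
theorem vertices_eq_Ico {k a p : ℕ} {u : Fin 2 →₀ ℕ} {N : Finset (Finset ℕ)}
    (hN : N ∈ closedSystems k a p u) (hp : p = a + k * u 0) : vertices N = Finset.Ico a p := by
  refine Finset.eq_of_subset_of_card_le hN.2 ?_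
  rw [hN.1.isSystem.card_vertices, hN.1.card_eq, Nat.card_Ico, hp]
  omega

/-- If `N₁ ∪ N₂ = N₁' ∪ N₂'` are two splittings whose first parts fill the vertices up to the
splitting point, the second splitting point cannot be the larger one. -/
theorem splitting_point_le {a p b p' : ℕ} (hap : a ≤ p)
    {N₁ N₂ N₁' N₂' : Finset (Finset ℕ)} (hu : N₁ ∪ N₂ = N₁' ∪ N₂')
    (h₁ : vertices N₁ = Finset.Ico a p) (h₂ : vertices N₂ ⊆ Finset.Ico (p + 1) b)
    (h₁' : vertices N₁' = Finset.Ico a p') : p' ≤ p := by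
  by_contra h
  have hmem : p ∈ vertices (N₁ ∪ N₂) := by
    rw [hu, vertices_union, h₁']
    exact Finset.mem_union_left _ (Finset.mem_Ico.2 ⟨hap, not_le.1 h⟩)
  rw [vertices_union, h₁, Finset.mem_union, Finset.mem_Ico] at hmem
  rcases hmem with hmem | hmem
  · omega
  · have := Finset.mem_Ico.1 (h₂ hmem)
    omega

theorem subset_of_union_eq {k : ℕ} (hk : 1 ≤ k) {N₁ N₂ N₁' N₂' : Finset (Finset ℕ)}
    (hs : IsSystem k N₁) (hu : N₁ ∪ N₂ = N₁' ∪ N₂')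
    (hd : Disjoint (vertices N₁) (vertices N₂')) : N₁ ⊆ N₁' := by
  intro A hA
  have hA' : A ∈ N₁' ∪ N₂' := hu ▸ Finset.mem_union_left _ hA
  refine (Finset.mem_union.1 hA').resolve_right fun h => ?_
  exact Finset.disjoint_left.1 (hs.disjoint_of_disjoint_vertices hk hd) hA h

/-- Splitting at the first uncovered vertex. -/
theorem ncard_closedSystems_succ {k : ℕ} (hk : 1 ≤ k) (a e : ℕ) (u : Fin 2 →₀ ℕ) :
    (closedSystems k a (a + k * u 0 + (e + 1)) u).ncard =
      ∑ q ∈ Finset.HasAntidiagonal.antidiagonal u, (closedSystems k a (a + k * q.1 0) q.1).ncard *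
        (closedSystems k (a + k * q.1 0 + 1) (a + k * q.1 0 + 1 + k * q.2 0 + e) q.2).ncard := by
  have hend : ∀ q ∈ Finset.HasAntidiagonal.antidiagonal u,
      a + k * u 0 + (e + 1) = a + k * q.1 0 + 1 + k * q.2 0 + e := by
    intro q hq
    rw [← Finset.HasAntidiagonal.mem_antidiagonal.1 hq, Finsupp.add_apply]
    ring
  simp_rw [← Set.ncard_prod]
  rw [Set.ncard_eq_toFinset_card _ (finite_closedSystems _ _ _ _),
    Finset.sum_congr rfl fun q _ => Set.ncard_eq_toFinset_card _
      ((finite_closedSystems _ _ _ _).prod (finite_closedSystems _ _ _ _)), ← Finset.card_sigma]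
  symm
  refine Finset.card_nbij (fun x => x.2.1 ∪ x.2.2) ?_ ?_ ?_
  · rintro ⟨q, N₁, N₂⟩ hx
    simp only [Finset.mem_coe, Finset.mem_sigma, Set.Finite.mem_toFinset, Set.mem_prod] at hx ⊢
    obtain ⟨hq, h₁, h₂⟩ := hx
    rw [hend q hq]
    have := union_mem_closedSystems hk (by omega) (by omega) h₁ h₂
    rwa [Finset.HasAntidiagonal.mem_antidiagonal.1 hq] at this
  · rintro ⟨⟨u₁, u₂⟩, N₁, N₂⟩ hx ⟨⟨u₁', u₂'⟩, N₁', N₂'⟩ hx' heq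
    simp only [Finset.mem_coe, Finset.mem_sigma, Set.Finite.mem_toFinset, Set.mem_prod]
      at hx hx' heq
    obtain ⟨-, h₁, h₂⟩ := hx
    obtain ⟨-, h₁', h₂'⟩ := hx'
    have hv₁ := vertices_eq_Ico h₁ rfl
    have hv₁' := vertices_eq_Ico h₁' rfl
    have hp : a + k * u₁ 0 = a + k * u₁' 0 := le_antisymm
      (splitting_point_le (by omega) heq.symm hv₁' h₂'.2 hv₁)
      (splitting_point_le (by omega) heq hv₁ h₂.2 hv₁')
    have hdisj : ∀ {p b : ℕ} {S S' : Finset ℕ}, S ⊆ Finset.Ico a p →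
        S' ⊆ Finset.Ico (p + 1) b → Disjoint S S' := by
      intro p b S S' hS hS'
      refine Finset.disjoint_left.2 fun v hv hv' => ?_
      have := Finset.mem_Ico.1 (hS hv)
      have := Finset.mem_Ico.1 (hS' hv')
      omega
    have hd := hdisj h₁.2 (hp ▸ h₂'.2)
    have hd' := hdisj h₁'.2 (hp ▸ h₂.2)
    obtain rfl : N₁ = N₁' := subset_antisymm (subset_of_union_eq hk h₁.1.isSystem heq hd)
      (subset_of_union_eq hk h₁'.1.isSystem heq.symm hd')
    rw [Finset.union_comm N₁, Finset.union_comm N₁] at heq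
    obtain rfl : N₂ = N₂' := subset_antisymm
      (subset_of_union_eq hk h₂.1.isSystem heq hd'.symm)
      (subset_of_union_eq hk h₂'.1.isSystem heq.symm hd.symm)
    have huniq : ∀ {v w : Fin 2 →₀ ℕ} {N : Finset (Finset ℕ)}, IsClosedSystem k v N →
        IsClosedSystem k w N → v = w := by
      intro v w N hv hw
      ext i
      fin_cases i
      · exact hv.card_eq.symm.trans hw.card_eq
      · exact hv.numShort_eq.symm.trans hw.numShort_eq
    obtain rfl := huniq h₁.1 h₁'.1
    obtain rfl := huniq h₂.1 h₂'.1
    rfl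
  · intro N hN
    simp only [Finset.mem_coe, Set.Finite.mem_toFinset] at hN
    have hex : ∃ p, a ≤ p ∧ p < a + k * u 0 + (e + 1) ∧ p ∉ vertices N := by
      by_contra! h
      have hsub : Finset.Ico a (a + k * u 0 + (e + 1)) ⊆ vertices N := fun v hv =>
        h v (Finset.mem_Ico.1 hv).1 (Finset.mem_Ico.1 hv).2
      have := Finset.card_le_card hsub
      rw [hN.1.isSystem.card_vertices, hN.1.card_eq, Nat.card_Ico] at this
      omega
    classical
    let p := Nat.find hex
    obtain ⟨hap, hpb, hp⟩ : a ≤ p ∧ p < a + k * u 0 + (e + 1) ∧ p ∉ vertices N :=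
      Nat.find_spec hex
    have hmin : ∀ v, a ≤ v → v < p → v ∈ vertices N := by
      intro v hav hvp
      by_contra hv
      exact Nat.find_min hex hvp ⟨hav, hvp.trans hpb, hv⟩
    obtain ⟨u₁, u₂, hu, N₁, h₁, N₂, h₂, rfl⟩ := exists_union_eq_of_notMem_vertices hk hN hp
    have hv₁ : vertices N₁ = Finset.Ico a p := by
      refine subset_antisymm h₁.2 fun v hv => ?_
      obtain ⟨hav, hvp⟩ := Finset.mem_Ico.1 hv
      have hvN := hmin v hav hvp
      rw [vertices_union] at hvN
      refine (Finset.mem_union.1 hvN).resolve_right fun h => ?_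
      have := Finset.mem_Ico.1 (h₂.2 h)
      omega
    have hpe : p = a + k * u₁ 0 := by
      have := h₁.1.isSystem.card_vertices
      rw [hv₁, Nat.card_Ico, h₁.1.card_eq] at this
      omega
    have hq : (u₁, u₂) ∈ Finset.HasAntidiagonal.antidiagonal u :=
      Finset.HasAntidiagonal.mem_antidiagonal.2 hu
    refine ⟨⟨(u₁, u₂), N₁, N₂⟩, ?_, rfl⟩
    simp only [Finset.mem_coe, Finset.mem_sigma, Set.Finite.mem_toFinset, Set.mem_prod]
    rw [hend _ hq] at h₂
    rw [hpe] at h₁ h₂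
    exact ⟨hq, h₁, h₂⟩

/-- The `e` uncovered vertices separate `e + 1` non-crossing diagrams. -/
theorem ncard_closedSystems {k : ℕ} (hk : 1 ≤ k) (e a : ℕ) (u : Fin 2 →₀ ℕ) :
    (closedSystems k a (a + k * u 0 + e) u).ncard = MvPowerSeries.coeff u (T k ^ (e + 1)) := by
  induction e generalizing a u with
  | zero => rw [zero_add, pow_one, add_zero, ncard_closedSystems_full hk]
  | succ e ih =>
    rw [ncard_closedSystems_succ hk, pow_succ', MvPowerSeries.coeff_mul]
    exact Finset.sum_congr rfl fun q _ => by rw [ncard_closedSystems_full hk, ih]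

end KChord

theorem theorem27 (k n l m : ℕ) (hk : 1 ≤ k) (hm : m ≤ n) :
    KChord.d k n l m =
      MvPowerSeries.coeff (Finsupp.single 0 m + Finsupp.single 1 l)
          (KChord.T k ^ (k * n - k * m + 1)) *
        KChord.dShort k (n - m) 0 := by
  have h0 : (Finsupp.single 0 m + Finsupp.single 1 l : Fin 2 →₀ ℕ) 0 = m := by simp
  have h1 : (Finsupp.single 0 m + Finsupp.single 1 l : Fin 2 →₀ ℕ) 1 = l := by simp
  rw [KChord.d, KChord.ncard_diagrams_eq hk (Fintype.card_fin _) h0 h1,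
    ← KChord.ncard_closedSystems hk (k * n - k * m) 0, h0, add_assoc,
    Nat.add_sub_cancel' (Nat.mul_le_mul_left k hm), KChord.ncard_closedSystems_add]
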